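/- Let $n_r\ge 1$, $n_t\ge 2$, let $\mathbb{H}$ be a real $n_r\times n_t$ matrix with nonnegative entries and of rank $r=n_t-1$, let $\sigma>0$ and $\alpha\in[0,1]^{n_t}$. Define the capacity of the equal-cost constrained MIMO optical intensity channel $\mathbf{Y}=\mathbb{H}\mathbf{X}+\mathbf{Z}$, where $\mathbf{Z}\sim\mathcal{N}(\mathbf{0},\sigma^2\mathbb{I}_{n_r})$ is independent of $\mathbf{X}$, by $$\mathsf{C}_{\mathrm{E}}(\mathbb{H},\alpha,\sigma)=\sup_{\mathscr{P}_{\mathbf{X}}} I(\mathbf{X};\mathbf{Y}),$$ where the supremum is over all probability laws of a random vector $\mathbf{X}\in\mathbb{R}^{n_t}$ that is almost surely nonnegative in every entry and satisfies $\mathbb{P}\{X_k>1\}=0$ and $\mathbb{E}[X_k]=\alpha_k$ for all $k\in\{1,\dots,n_t\}$. Here $I$ denotes mutual information. Let $\mathbb{H}=\mathbb{U}\mathbb{B}\mathbb{V}^{\mathsf T}$ be a singular value decomposition: $\mathbb{U}$ and $\mathbb{V}$ are orthogonal matrices of sizes $n_r$ and $n_t$, the first $r$ diagonal entries of the $n_r\times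 n_t$ matrix $\mathbb{B}$ are $\sigma_1\ge\dots\ge\sigma_r>0$, and all its other entries are zero. Let $\mathbf{v}_j$ be the $j$-th column of $\mathbb{V}$ and $v_j^{(i)}$ its $i$-th entry. Put $\widetilde{\mathbb{H}}=\mathrm{diag}(\sigma_1,\dots,\sigma_r)\,[\mathbf{v}_1\cdots\mathbf{v}_r]^{\mathsf T}$, an $r\times n_t$ matrix with columns $\widetilde{\mathbf{h}}_1,\dots,\widetilde{\mathbf{h}}_{n_t}$, let $\mathcal{R}(\widetilde{\mathbb{H}})=\{\sum_{i=1}^{n_t}x_i\widetilde{\mathbf{h}}_i : x_i\in[0,1]\text{ for all }i\}$ be the zonotope that they generate, and for $\mathbf{s}\in\mathbb{R}^{n_t-1}$ let $$f_{\min}(\mathbf{s})=\max_{i:\,v_{n_t}^{(i)}\neq 0}\left\{\frac{1-\mathrm{sign}(v_{n_t}^{(i)})}{2v_{n_t}^{(i)}}-\sum_{j=1}^{n_t-1}\frac{v_j^{(i)}s_j}{v_{n_t}^{(i)}\sigma_j}\right\}.$$ Then $$\mathsf{C}_{\mathrm{E}}(\mathbb{H},\alpha,\sigma)=\sup_{\mathscr{P}_{\mathbf{S}}}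 I(\mathbf{S};\mathbf{S}+\widetilde{\mathbf{Z}}),$$ where $\widetilde{\mathbf{Z}}\sim\mathcal{N}(\mathbf{0},\sigma^2\mathbb{I}_{n_t-1})$ is independent of $\mathbf{S}$ and the supremum is over all probability laws of a random vector $\mathbf{S}\in\mathbb{R}^{n_t-1}$ with $\mathrm{supp}\,\mathbf{S}\subseteq\mathcal{R}(\widetilde{\mathbb{H}})$, $$\mathbb{E}[\mathbf{S}]=\widetilde{\mathbb{H}}\alpha,\qquad \mathbb{E}[f_{\min}(\mathbf{S})]\le\mathbf{v}_{n_t}^{\mathsf T}\alpha,\qquad \mathbb{E}[f_{\min}(\widetilde{\mathbb{H}}\mathbf{1}-\mathbf{S})]\le\mathbf{v}_{n_t}^{\mathsf T}(\mathbf{1}-\alpha).$$ -/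

import Mathlib

open MeasureTheory ProbabilityTheory InformationTheory
open scoped ENNReal Matrix

namespace OpticalChannel

noncomputable section

/-- The mutual information `I(X; Y)` (in nats, possibly `∞`) of two random variables on a
probability space: the Kullback-Leibler divergence of their joint law from the product of
their marginal laws. -/
def mutualInfo {Ω 𝓧 𝓨 : Type*} [MeasurableSpace Ω] [MeasurableSpace 𝓧] [MeasurableSpace 𝓨]
    (μ : Measure Ω) (X : Ω → 𝓧) (Y : Ω → 𝓨) : ℝ≥0∞ :=
  klDiv (μ.map fun ω => (X ω, Y ω)) ((μ.map X).prod (μ.map Y))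

/-- The action of a real matrix on Euclidean vectors. -/
def act {m n : ℕ} (A : Matrix (Fin m) (Fin n) ℝ) (x : EuclideanSpace ℝ (Fin n)) :
    EuclideanSpace ℝ (Fin m) :=
  WithLp.toLp 2 (A *ᵥ x.ofLp)

/-- The law `𝒩(0, σ² I_k)` of the white Gaussian noise in `k` dimensions. -/
def noise (k : ℕ) (σ : ℝ) : Measure (EuclideanSpace ℝ (Fin k)) :=
  multivariateGaussian 0 (σ ^ 2 • (1 : Matrix (Fin k) (Fin k) ℝ))

/-- `I(X; HX + Z)`, where `X` has law `P` and `Z ∼ 𝒩(0, σ² I)` is independent of `X`. -/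
def channelInfo {m n : ℕ} (H : Matrix (Fin m) (Fin n) ℝ) (σ : ℝ)
    (P : Measure (EuclideanSpace ℝ (Fin n))) : ℝ≥0∞ :=
  mutualInfo (P.prod (noise m σ)) (fun p => p.1) (fun p => act H p.1 + p.2)

/-- The input law `P` is nonnegative, satisfies the per-antenna peak-intensity constraints
`ℙ(X_k > 1) = 0`, and the average-intensity equality constraints `𝔼[X_k] = α_k`. -/
structure EqualCost {n : ℕ} (α : Fin n → ℝ) (P : Measure (EuclideanSpace ℝ (Fin n))) :
    Prop where
  nonneg : ∀ᵐ x ∂P, ∀ k, 0 ≤ x k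
  peak : ∀ k, P {x | 1 < x k} = 0
  mean : ∀ k, ∫ x, x k ∂P = α k

/-- The (single-letter) capacity of the equal-cost constrained optical intensity channel
`Y = HX + Z`: the supremum of `I(X; Y)` over all admissible input laws. -/
def capacityEC {m n : ℕ} (H : Matrix (Fin m) (Fin n) ℝ) (α : Fin n → ℝ) (σ : ℝ) : ℝ≥0∞ :=
  ⨆ (P : Measure (EuclideanSpace ℝ (Fin n))) (_ : IsProbabilityMeasure P)
    (_ : EqualCost α P), channelInfo H σ P

/-- The `m × n` matrix whose first `r` diagonal entries are `s 0, …, s (r - 1)` and whose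
other entries are zero. -/
def rectDiag (m n : ℕ) {r : ℕ} (s : Fin r → ℝ) : Matrix (Fin m) (Fin n) ℝ :=
  Matrix.of fun i j =>
    if h : i.val = j.val ∧ i.val < r then s ⟨i.val, h.2⟩ else 0

/-- `H = U B Vᵀ` is a singular value decomposition of the matrix `H` of rank `r`, with nonzero
singular values `s 0 ≥ ⋯ ≥ s (r - 1) > 0`. -/
structure IsSVD {m n r : ℕ} (H : Matrix (Fin m) (Fin n) ℝ) (U : Matrix (Fin m) (Fin m) ℝ)
    (s : Fin r → ℝ) (V : Matrix (Fin n) (Fin n) ℝ) : Prop where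
  le_rows : r ≤ m
  le_cols : r ≤ n
  orthogonal_left : U ∈ Matrix.orthogonalGroup (Fin m) ℝ
  orthogonal_right : V ∈ Matrix.orthogonalGroup (Fin n) ℝ
  pos : ∀ j, 0 < s j
  antitone : Antitone s
  eq : H = U * rectDiag m n s * Vᵀ

/-- The transformed channel matrix `H̃ = B₁₁ V₁ᵀ`, with `B₁₁ = diag s` and `V₁` consisting of
the first `r` of the `r + 1` columns of `V`. -/
def reduced {r : ℕ} (s : Fin r → ℝ) (V : Matrix (Fin (r + 1)) (Fin (r + 1)) ℝ) :
    Matrix (Fin r) (Fin (r + 1)) ℝ :=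
  Matrix.diagonal s * (V.submatrix id Fin.castSucc)ᵀ

/-- The zonotope generated by the columns of `A`. -/
def zonotope {r n : ℕ} (A : Matrix (Fin r) (Fin n) ℝ) : Set (EuclideanSpace ℝ (Fin r)) :=
  {y | ∃ x : Fin n → ℝ, (∀ i, x i ∈ Set.Icc (0 : ℝ) 1) ∧
    y = ∑ i, x i • WithLp.toLp 2 (fun j => A j i)}

/-- The function `f_min`. Here `V i (Fin.last r)` is the `i`-th entry of the last column of
`V`, and the supremum is a maximum over finitely many indices, of which there is at least one
whenever `V` is orthogonal. -/
def fmin {r : ℕ} (s : Fin r → ℝ) (V : Matrix (Fin (r + 1)) (Fin (r + 1)) ℝ)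
    (y : EuclideanSpace ℝ (Fin r)) : ℝ :=
  ⨆ i : {i : Fin (r + 1) // V i (Fin.last r) ≠ 0},
    ((1 - Real.sign (V i (Fin.last r))) / (2 * V i (Fin.last r))
      - ∑ j : Fin r, V i j.castSucc * y j / (V i (Fin.last r) * s j))

end

end OpticalChannel

/-! The matrix factors as `A * reduced s V` with `A` an isometry, so the output sees the input `X`
only through `S = reduced s V · X`, and noise orthogonal to the range of `A` is irrelevant. Data
processing in both directions (`channelInfo_mul_le`, `le_channelInfo_map`) reduces the claim to
identifying the possible laws of `S`. The fibre of `reduced s V` over `y` is a line in the direction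
of the last column `v` of `V`, with coordinate `t = v ⬝ᵥ x`. It meets the cube in the segment from
`fmin y` to `v ⬝ᵥ 1 - fmin (reduced s V · 1 - y)`, the upper end coming from the reflection `x ↦ 1 -
x`. Since `V` is orthogonal, `𝔼 X = α` means that `S` and `t` have the right means. Averaging the
bounds on `t` gives necessity (`EqualCost.isAdmissible_map`). Conversely, a fixed convex combination
of the two ends gives `t` the required mean, with `X` a function of `S`
(`IsAdmissible.exists_equalCost_map`). -/

namespace OpticalChannel

/-! ### Data processing for mutual information. -/

section MutualInformation

variable {Ω Ω' 𝓧 𝓧' 𝓨 𝓨' 𝓩 : Type*} [MeasurableSpace Ω] [MeasurableSpace Ω']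
  [MeasurableSpace 𝓧] [MeasurableSpace 𝓧'] [MeasurableSpace 𝓨] [MeasurableSpace 𝓨']
  [MeasurableSpace 𝓩]

lemma mutualInfo_map {μ : Measure Ω} {f : Ω → Ω'} (hf : Measurable f) {X : Ω' → 𝓧} {Y : Ω' → 𝓨}
    (hX : Measurable X) (hY : Measurable Y) :
    mutualInfo (μ.map f) X Y = mutualInfo μ (X ∘ f) (Y ∘ f) := by
  unfold mutualInfo
  rw [Measure.map_map (hX.prodMk hY) hf, Measure.map_map hX hf, Measure.map_map hY hf]
  rfl

/-- Data processing on both sides by deterministic maps. -/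
lemma mutualInfo_comp_le {μ : Measure Ω} [IsProbabilityMeasure μ] {X : Ω → 𝓧} {Y : Ω → 𝓨}
    (hX : Measurable X) (hY : Measurable Y) {f : 𝓧 → 𝓧'} {g : 𝓨 → 𝓨'}
    (hf : Measurable f) (hg : Measurable g) :
    mutualInfo μ (f ∘ X) (g ∘ Y) ≤ mutualInfo μ X Y := by
  have := Measure.isProbabilityMeasure_map (μ := μ) hX.aemeasurable
  have := Measure.isProbabilityMeasure_map (μ := μ) hY.aemeasurable
  have := Measure.isProbabilityMeasure_map (μ := μ) (hX.prodMk hY).aemeasurable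
  unfold mutualInfo
  rw [← Measure.map_map hf hX, ← Measure.map_map hg hY, Measure.map_prod_map _ _ hf hg]
  have h := klDiv_map_le (μ.map fun ω => (X ω, Y ω)) ((μ.map X).prod (μ.map Y))
    (hf.prodMap hg)
  rwa [Measure.map_map (hf.prodMap hg) (hX.prodMk hY)] at h

/-- Appending independent noise to the output does not change the mutual information. -/
lemma mutualInfo_prodMk_indep {μ : Measure Ω} [IsProbabilityMeasure μ]
    {ν : Measure 𝓩} [IsProbabilityMeasure ν] {X : Ω → 𝓧} {Y : Ω → 𝓨}
    (hX : Measurable X) (hY : Measurable Y) :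
    mutualInfo (μ.prod ν) (fun p => X p.1) (fun p => (Y p.1, p.2)) = mutualInfo μ X Y := by
  have := Measure.isProbabilityMeasure_map (μ := μ) hX.aemeasurable
  have := Measure.isProbabilityMeasure_map (μ := μ) hY.aemeasurable
  have := Measure.isProbabilityMeasure_map (μ := μ) (hX.prodMk hY).aemeasurable
  have hassoc : Measurable (fun p : (𝓧 × 𝓨) × 𝓩 => (p.1.1, (p.1.2, p.2))) := by fun_prop
  have hassoc' : Measurable (fun p : 𝓧 × (𝓨 × 𝓩) => ((p.1, p.2.1), p.2.2)) := by fun_prop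
  have h1 : (μ.prod ν).map (fun p => (X p.1, (Y p.1, p.2))) =
      ((μ.map fun ω => (X ω, Y ω)).prod ν).map
        (fun p : (𝓧 × 𝓨) × 𝓩 => (p.1.1, (p.1.2, p.2))) := by
    conv_rhs => rw [← Measure.map_id (μ := ν)]
    rw [Measure.map_prod_map _ _ (hX.prodMk hY) measurable_id,
      Measure.map_map hassoc ((hX.prodMk hY).prodMap measurable_id)]
    rfl
  have h2 : (μ.prod ν).map (fun p => X p.1) = μ.map X := by
    rw [← Function.comp_def X Prod.fst, ← Measure.map_map hX measurable_fst,
      Measure.map_fst_prod]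
    simp
  have h3 : (μ.prod ν).map (fun p => (Y p.1, p.2)) = (μ.map Y).prod ν := by
    conv_rhs => rw [← Measure.map_id (μ := ν)]
    rw [Measure.map_prod_map _ _ hY measurable_id]
    rfl
  have h4 : (μ.map X).prod ((μ.map Y).prod ν) = (((μ.map X).prod (μ.map Y)).prod ν).map
      (fun p : (𝓧 × 𝓨) × 𝓩 => (p.1.1, (p.1.2, p.2))) :=
    (Measure.prodAssoc_prod (μ := μ.map X) (ν := μ.map Y) (τ := ν)).symm
  -- Extending both laws by the same kernel, here a constant one, leaves the divergence unchanged.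
  have key : klDiv ((μ.map fun ω => (X ω, Y ω)).prod ν) (((μ.map X).prod (μ.map Y)).prod ν) =
      klDiv (μ.map fun ω => (X ω, Y ω)) ((μ.map X).prod (μ.map Y)) := by
    rw [← Measure.compProd_const, ← Measure.compProd_const, klDiv_compProd_left]
  unfold mutualInfo
  rw [h1, h2, h3, h4]
  -- Reassociation is invertible, so data processing applies in both directions.
  refine le_antisymm ((klDiv_map_le _ _ hassoc).trans key.le) ?_
  rw [← key]
  have := Measure.isProbabilityMeasure_map
    (μ := (μ.map fun ω => (X ω, Y ω)).prod ν) hassoc.aemeasurable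
  have := Measure.isProbabilityMeasure_map
    (μ := ((μ.map X).prod (μ.map Y)).prod ν) hassoc.aemeasurable
  have h := klDiv_map_le (((μ.map fun ω => (X ω, Y ω)).prod ν).map
    (fun p : (𝓧 × 𝓨) × 𝓩 => (p.1.1, (p.1.2, p.2)))) ((((μ.map X).prod (μ.map Y)).prod ν).map
    (fun p : (𝓧 × 𝓨) × 𝓩 => (p.1.1, (p.1.2, p.2)))) hassoc'
  rw [Measure.map_map hassoc' hassoc, Measure.map_map hassoc' hassoc] at h
  simpa [Function.comp_def] using h

/-- Disintegration of `P` along `f`, tested on a product of a function of `f x` and an indicator in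
`x`. -/
lemma lintegral_condDistrib_id_mul [StandardBorelSpace 𝓧] [Nonempty 𝓧] {P : Measure 𝓧}
    [IsProbabilityMeasure P] {f : 𝓧 → 𝓧'} (hf : Measurable f) {A : Set 𝓧} (hA : MeasurableSet A)
    {h : 𝓧' → ℝ≥0∞} (hh : Measurable h) :
    ∫⁻ s, condDistrib id f P s A * h s ∂(P.map f) = ∫⁻ x in A, h (f x) ∂P := by
  have := Measure.isProbabilityMeasure_map (μ := P) hf.aemeasurable
  have hm : Measurable fun q : 𝓧' × 𝓧 => A.indicator (fun _ => h q.1) q.2 :=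
    (hh.comp measurable_fst).indicator (measurable_snd hA)
  have h1 := Measure.lintegral_compProd (μ := P.map f) (κ := condDistrib id f P) hm
  rw [compProd_map_condDistrib (measurable_id.aemeasurable),
    lintegral_map hm (hf.prodMk measurable_id)] at h1
  simp only [id] at h1
  rw [← lintegral_indicator hA]
  refine Eq.trans ?_ (h1.symm.trans ?_)
  · refine lintegral_congr fun s => ?_
    rw [lintegral_indicator hA, setLIntegral_const, mul_comm]
  · rfl

/-- If the output depends on the input `x` only through `f x`, then replacing the input by `f x`
does not decrease the mutual information. -/
lemma mutualInfo_le_of_factor [StandardBorelSpace 𝓧] [Nonempty 𝓧] {P : Measure 𝓧}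
    [IsProbabilityMeasure P] {ν : Measure 𝓩} [IsProbabilityMeasure ν]
    {f : 𝓧 → 𝓧'} (hf : Measurable f) {g : 𝓧' × 𝓩 → 𝓨} (hg : Measurable g) :
    mutualInfo (P.prod ν) (fun p => p.1) (fun p => g (f p.1, p.2)) ≤
      mutualInfo ((P.map f).prod ν) (fun p => p.1) g := by
  have := Measure.isProbabilityMeasure_map (μ := P) hf.aemeasurable
  set Q := P.map f with hQ
  -- The backward channel, which resamples the input `x` given `f x`.
  set κ := condDistrib id f P with hκ
  have hgf : Measurable fun p : 𝓧 × 𝓩 => g (f p.1, p.2) := by fun_prop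
  have hN : (P.prod ν).map (fun p => g (f p.1, p.2)) = (Q.prod ν).map g := by
    conv_rhs => rw [hQ, ← Measure.map_id (μ := ν)]
    rw [Measure.map_prod_map _ _ hf measurable_id,
      Measure.map_map hg (hf.prodMap measurable_id)]
    rfl
  have := Measure.isProbabilityMeasure_map (μ := Q.prod ν) hg.aemeasurable
  have := Measure.isProbabilityMeasure_map (μ := Q.prod ν)
    (measurable_fst.prodMk hg).aemeasurable
  have := Measure.isProbabilityMeasure_map (μ := P.prod ν)
    (measurable_fst.prodMk hgf).aemeasurable
  have hbind (M : Measure (𝓧' × 𝓨)) {A : Set 𝓧} {B : Set 𝓨} (hA : MeasurableSet A)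
      (hB : MeasurableSet B) : ((κ ∥ₖ (Kernel.id : Kernel 𝓨 𝓨)) ∘ₘ M) (A ×ˢ B) =
        ∫⁻ q, κ q.1 A * B.indicator 1 q.2 ∂M := by
    rw [Measure.bind_apply (hA.prod hB) (Kernel.aemeasurable _)]
    refine lintegral_congr fun q => ?_
    rw [Kernel.parallelComp_apply_prod, Kernel.id_apply, Measure.dirac_apply' _ hB]
  -- The output is conditionally independent of `x` given `f x`, so resampling `x` by `κ` restores
  -- the joint law.
  have hjoint : (P.prod ν).map (fun p => (p.1, g (f p.1, p.2))) =
      (κ ∥ₖ (Kernel.id : Kernel 𝓨 𝓨)) ∘ₘ ((Q.prod ν).map fun p => (p.1, g p)) := by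
    refine Measure.ext_prod fun {A B} hA hB => ?_
    have hBi : Measurable (B.indicator (1 : 𝓨 → ℝ≥0∞)) := measurable_one.indicator hB
    have hκA : Measurable fun s => κ s A := Kernel.measurable_coe κ hA
    have hκB : Measurable fun q : 𝓧' × 𝓨 => κ q.1 A * B.indicator 1 q.2 :=
      (hκA.comp measurable_fst).mul (hBi.comp measurable_snd)
    have hgB : Measurable fun p : 𝓧' × 𝓩 => B.indicator (1 : 𝓨 → ℝ≥0∞) (g p) := hBi.comp hg
    have hκg : Measurable fun p : 𝓧' × 𝓩 => κ p.1 A * B.indicator 1 (g p) :=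
      (hκA.comp measurable_fst).mul hgB
    rw [hbind _ hA hB, lintegral_map hκB (measurable_fst.prodMk hg),
      lintegral_prod _ hκg.aemeasurable]
    have h1 : ∀ s, ∫⁻ z, κ s A * B.indicator 1 (g (s, z)) ∂ν =
        κ s A * ∫⁻ z, B.indicator 1 (g (s, z)) ∂ν := fun s =>
      lintegral_const_mul _ (hgB.comp measurable_prodMk_left)
    simp only [h1]
    rw [lintegral_condDistrib_id_mul hf hA hgB.lintegral_prod_right',
      Measure.map_apply (measurable_fst.prodMk hgf) (hA.prod hB),
      Measure.prod_apply ((measurable_fst.prodMk hgf) (hA.prod hB)), ← lintegral_indicator hA]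
    refine lintegral_congr fun x => ?_
    by_cases hx : x ∈ A
    · rw [Set.indicator_of_mem hx]
      have hm : MeasurableSet {z | g (f x, z) ∈ B} := hg.comp measurable_prodMk_left hB
      rw [← lintegral_indicator_one (by simpa [Set.preimage, hx] using hm)]
      refine lintegral_congr fun z => ?_
      by_cases hz : g (f x, z) ∈ B <;> simp [Set.indicator, hx, hz]
    · have : Prod.mk x ⁻¹' ((fun p : 𝓧 × 𝓩 => (p.1, g (f p.1, p.2))) ⁻¹' A ×ˢ B) = ∅ := by
        ext z
        simp [hx]
      rw [Set.indicator_of_notMem hx, this, measure_empty]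
  -- The same kernel also carries product law to product law, so the divergence cannot increase.
  have hprod : P.prod ((Q.prod ν).map g) =
      (κ ∥ₖ (Kernel.id : Kernel 𝓨 𝓨)) ∘ₘ (Q.prod ((Q.prod ν).map g)) := by
    refine Measure.ext_prod fun {A B} hA hB => ?_
    have hBi : Measurable (B.indicator (1 : 𝓨 → ℝ≥0∞)) := measurable_one.indicator hB
    have hκA : Measurable fun s => κ s A := Kernel.measurable_coe κ hA
    have h1 := lintegral_condDistrib_id_mul (P := P) hf hA
      (measurable_const (a := (1 : ℝ≥0∞)))
    simp only [mul_one, setLIntegral_const, one_mul] at h1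
    rw [hbind _ hA hB, lintegral_prod_mul hκA.aemeasurable hBi.aemeasurable,
      lintegral_indicator_one hB, h1, Measure.prod_prod]
  unfold mutualInfo
  rw [hN, Measure.map_fst_prod, Measure.map_fst_prod, measure_univ, one_smul, one_smul,
    hjoint, hprod]
  exact klDiv_comp_right_le _ _ _

end MutualInformation

end OpticalChannel

namespace OpticalChannel

/-! ### Matrices acting on Euclidean space. -/

section Action

variable {k m n : ℕ}

lemma act_apply (A : Matrix (Fin m) (Fin n) ℝ) (x : EuclideanSpace ℝ (Fin n)) (i : Fin m) :
    act A x i = ∑ j, A i j * x j := rfl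

@[fun_prop]
lemma continuous_act (A : Matrix (Fin m) (Fin n) ℝ) : Continuous (act A) := by
  unfold act
  fun_prop

@[fun_prop]
lemma measurable_act (A : Matrix (Fin m) (Fin n) ℝ) : Measurable (act A) :=
  (continuous_act A).measurable

lemma act_add (A : Matrix (Fin m) (Fin n) ℝ) (x y : EuclideanSpace ℝ (Fin n)) :
    act A (x + y) = act A x + act A y := by
  simp [act, Matrix.mulVec_add]

lemma act_sub (A : Matrix (Fin m) (Fin n) ℝ) (x y : EuclideanSpace ℝ (Fin n)) :
    act A (x - y) = act A x - act A y := by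
  simp [act, Matrix.mulVec_sub]

lemma act_mul (A : Matrix (Fin k) (Fin m) ℝ) (B : Matrix (Fin m) (Fin n) ℝ)
    (x : EuclideanSpace ℝ (Fin n)) : act (A * B) x = act A (act B x) := by
  simp [act, Matrix.mulVec_mulVec]

lemma act_one (x : EuclideanSpace ℝ (Fin n)) : act 1 x = x := by
  simp [act]

lemma inner_act (A : Matrix (Fin m) (Fin n) ℝ) (x : EuclideanSpace ℝ (Fin n))
    (y : EuclideanSpace ℝ (Fin m)) : inner ℝ (act A x) y = inner ℝ x (act Aᵀ y) := by
  simp only [EuclideanSpace.inner_eq_star_dotProduct, act, star_trivial]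
  rw [Matrix.mulVec_transpose, ← Matrix.dotProduct_mulVec]

lemma norm_sq_act_transpose (A : Matrix (Fin m) (Fin n) ℝ) (t : EuclideanSpace ℝ (Fin m)) :
    ‖act Aᵀ t‖ ^ 2 = inner ℝ t (act (A * Aᵀ) t) := by
  rw [← real_inner_self_eq_norm_sq, inner_act, Matrix.transpose_transpose, act_mul]

end Action

/-! ### White Gaussian noise under isometries. -/

section Noise

variable {m n : ℕ}

instance (k : ℕ) (σ : ℝ) : IsProbabilityMeasure (noise k σ) := by
  unfold noise
  infer_instance

lemma charFun_noise (k : ℕ) (σ : ℝ) (t : EuclideanSpace ℝ (Fin k)) :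
    charFun (noise k σ) t = Complex.exp (-(σ ^ 2 * ‖t‖ ^ 2 / 2 : ℝ)) := by
  have hS : (σ ^ 2 • (1 : Matrix (Fin k) (Fin k) ℝ)).PosSemidef :=
    Matrix.PosSemidef.one.smul (sq_nonneg σ)
  rw [noise, charFun_multivariateGaussian hS]
  congr 1
  have : t.ofLp ⬝ᵥ t.ofLp = ‖t‖ ^ 2 := by
    rw [← real_inner_self_eq_norm_sq, EuclideanSpace.inner_eq_star_dotProduct, star_trivial]
  rw [Matrix.smul_mulVec, Matrix.one_mulVec, dotProduct_smul, this]
  simp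

lemma charFun_map_act (A : Matrix (Fin m) (Fin n) ℝ) (μ : Measure (EuclideanSpace ℝ (Fin n)))
    (t : EuclideanSpace ℝ (Fin m)) :
    charFun (μ.map (act A)) t = charFun μ (act Aᵀ t) := by
  rw [charFun_apply, charFun_apply, integral_map (by fun_prop) (by fun_prop)]
  simp only [inner_act]

instance (A : Matrix (Fin m) (Fin n) ℝ) (μ : Measure (EuclideanSpace ℝ (Fin n)))
    [IsProbabilityMeasure μ] : IsProbabilityMeasure (μ.map (act A)) :=
  Measure.isProbabilityMeasure_map (by fun_prop)

/-- The characteristic function of white noise depends on `t` only through its norm, which `A`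
preserves. -/
lemma noise_map_act_transpose {A : Matrix (Fin m) (Fin n) ℝ} (hA : Aᵀ * A = 1) (σ : ℝ) :
    (noise m σ).map (act Aᵀ) = noise n σ := by
  refine Measure.ext_of_charFun (funext fun t => ?_)
  rw [charFun_map_act, charFun_noise, charFun_noise, norm_sq_act_transpose,
    Matrix.transpose_transpose, hA, act_one, real_inner_self_eq_norm_sq]

/-- White noise in `m` dimensions splits into a component along the range of an isometry `A` and
an independent component along its orthogonal complement. -/
lemma noise_eq_map_prod {A : Matrix (Fin m) (Fin n) ℝ} (hA : Aᵀ * A = 1) (σ : ℝ) :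
    noise m σ = ((noise n σ).prod (noise m σ)).map
      (fun p => act A p.1 + act (1 - A * Aᵀ) p.2) := by
  have hconv : ((noise n σ).prod (noise m σ)).map
      (fun p => act A p.1 + act (1 - A * Aᵀ) p.2) =
        (noise n σ).map (act A) ∗ (noise m σ).map (act (1 - A * Aᵀ)) := by
    rw [Measure.conv, Measure.map_prod_map _ _ (by fun_prop) (by fun_prop),
      Measure.map_map (by fun_prop) (by fun_prop)]
    rfl
  -- `1 - A * Aᵀ` is an orthogonal projection, so the two squared norms below add up to `‖t‖ ^ 2`.
  have hC : (1 - A * Aᵀ) * (1 - A * Aᵀ)ᵀ = 1 - A * Aᵀ := by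
    have : A * Aᵀ * (A * Aᵀ) = A * Aᵀ := by
      rw [Matrix.mul_assoc, ← Matrix.mul_assoc Aᵀ, hA, Matrix.one_mul]
    simp [Matrix.transpose_sub, Matrix.transpose_mul, mul_sub, sub_mul, this]
  rw [hconv]
  refine Measure.ext_of_charFun (funext fun t => ?_)
  rw [charFun_conv, charFun_map_act, charFun_map_act, charFun_noise, charFun_noise,
    charFun_noise, norm_sq_act_transpose, norm_sq_act_transpose, hC, ← Complex.exp_add]
  have : inner ℝ t (act (1 - A * Aᵀ) t) = ‖t‖ ^ 2 - inner ℝ t (act (A * Aᵀ) t) := by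
    rw [← real_inner_self_eq_norm_sq, ← inner_sub_right]
    congr 1
    simp [act, Matrix.sub_mulVec]
  rw [this]
  congr 1
  push_cast
  ring

end Noise

/-! ### Reduction to the identity channel. -/

section Channel

variable {m n r : ℕ}

/-- For a channel matrix `A * B` with `A` an isometry, the information about the input is at most
the information about its image under `B` in the channel with matrix `1`. -/
lemma channelInfo_mul_le {A : Matrix (Fin m) (Fin r) ℝ} (hA : Aᵀ * A = 1)
    (B : Matrix (Fin r) (Fin n) ℝ) (σ : ℝ) (P : Measure (EuclideanSpace ℝ (Fin n)))
    [IsProbabilityMeasure P] :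
    channelInfo (A * B) σ P ≤ mutualInfo ((P.map (act B)).prod (noise r σ))
      (fun p => p.1) (fun p => p.1 + p.2) := by
  have hsplit : P.prod (noise m σ) = ((P.prod (noise r σ)).prod (noise m σ)).map
      (fun p => (p.1.1, act A p.1.2 + act (1 - A * Aᵀ) p.2)) := by
    conv_lhs => rw [noise_eq_map_prod hA σ, ← Measure.map_id (μ := P)]
    rw [Measure.map_prod_map _ _ measurable_id (by fun_prop),
      ← (Measure.prodAssoc_prod (μ := P) (ν := noise r σ) (τ := noise m σ)),
      Measure.map_map (by fun_prop) (by fun_prop)]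
    rfl
  -- With the noise split, the output is a function of the reduced output and an independent
  -- remainder.
  have hY : (fun p : EuclideanSpace ℝ (Fin n) × EuclideanSpace ℝ (Fin m) =>
      act (A * B) p.1 + p.2) ∘ (fun p : (EuclideanSpace ℝ (Fin n) × EuclideanSpace ℝ (Fin r)) ×
        EuclideanSpace ℝ (Fin m) => (p.1.1, act A p.1.2 + act (1 - A * Aᵀ) p.2)) =
      (fun q : EuclideanSpace ℝ (Fin r) × EuclideanSpace ℝ (Fin m) =>
        act A q.1 + act (1 - A * Aᵀ) q.2) ∘ (fun p => (act B p.1.1 + p.1.2, p.2)) := by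
    funext p
    simp only [Function.comp, act_mul A B, act_add]
    abel
  unfold channelInfo
  rw [hsplit, mutualInfo_map (by fun_prop) (by fun_prop) (by fun_prop), hY]
  calc _ ≤ mutualInfo ((P.prod (noise r σ)).prod (noise m σ)) (fun p => p.1.1)
        (fun p => (act B p.1.1 + p.1.2, p.2)) :=
        mutualInfo_comp_le (X := fun p : (EuclideanSpace ℝ (Fin n) × EuclideanSpace ℝ (Fin r)) ×
          EuclideanSpace ℝ (Fin m) => p.1.1) (by fun_prop) (by fun_prop) measurable_id (by fun_prop)
    _ = mutualInfo (P.prod (noise r σ)) (fun p => p.1) (fun p => act B p.1 + p.2) :=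
        mutualInfo_prodMk_indep (μ := P.prod (noise r σ)) (ν := noise m σ) (X := fun p => p.1)
          (Y := fun p => act B p.1 + p.2) (by fun_prop) (by fun_prop)
    _ ≤ _ := mutualInfo_le_of_factor (P := P) (ν := noise r σ) (f := act B)
          (g := fun p => p.1 + p.2) (by fun_prop) (by fun_prop)

/-- If `g` is a section of `B`, the input `g S` conveys at least the information that `S`
conveys in the channel with matrix `1`. -/
lemma le_channelInfo_map {A : Matrix (Fin m) (Fin r) ℝ} (hA : Aᵀ * A = 1)
    (B : Matrix (Fin r) (Fin n) ℝ) (σ : ℝ) (Q : Measure (EuclideanSpace ℝ (Fin r)))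
    [IsProbabilityMeasure Q] {g : EuclideanSpace ℝ (Fin r) → EuclideanSpace ℝ (Fin n)}
    (hg : Measurable g) (hgB : ∀ y, act B (g y) = y) :
    mutualInfo (Q.prod (noise r σ)) (fun p => p.1) (fun p => p.1 + p.2) ≤
      channelInfo (A * B) σ (Q.map g) := by
  have h1 : Q.prod (noise r σ) = (Q.prod (noise m σ)).map (Prod.map id (act Aᵀ)) := by
    conv_lhs => rw [← noise_map_act_transpose hA σ, ← Measure.map_id (μ := Q)]
    exact Measure.map_prod_map _ _ measurable_id (by fun_prop)
  have h2 : (Q.map g).prod (noise m σ) = (Q.prod (noise m σ)).map (Prod.map g id) := by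
    conv_lhs => rw [← Measure.map_id (μ := noise m σ)]
    exact Measure.map_prod_map _ _ hg measurable_id
  unfold channelInfo
  rw [h1, h2, mutualInfo_map (by fun_prop) (by fun_prop) (by fun_prop),
    mutualInfo_map (by fun_prop) (by fun_prop) (by fun_prop)]
  -- Here `B` recovers `S` from the input and `Aᵀ` recovers the reduced output, so data processing
  -- applies.
  have hX : (fun p : EuclideanSpace ℝ (Fin r) × EuclideanSpace ℝ (Fin r) => p.1) ∘
      Prod.map id (act Aᵀ) = act B ∘ ((fun p => p.1) ∘
        (Prod.map g id : _ → _ × EuclideanSpace ℝ (Fin m))) := by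
    funext p
    simp [hgB]
  have hY : (fun p : EuclideanSpace ℝ (Fin r) × EuclideanSpace ℝ (Fin r) => p.1 + p.2) ∘
      Prod.map id (act Aᵀ) = act Aᵀ ∘ ((fun p => act (A * B) p.1 + p.2) ∘
        (Prod.map g id : _ → _ × EuclideanSpace ℝ (Fin m))) := by
    funext p
    simp [act_add, act_mul A B, hgB, ← act_mul Aᵀ A, hA, act_one]
  rw [hX, hY]
  exact mutualInfo_comp_le (by fun_prop) (by fun_prop) (by fun_prop) (by fun_prop)

end Channel

end OpticalChannel

namespace OpticalChannel

/-! ### Fibres of the reduced matrix in the cube. -/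

section Geometry

variable {r : ℕ}

/-- `A` consists of the first `r` columns of `U`: the zero rows and the zero last column of the
diagonal factor remove the rest. -/
lemma IsSVD.exists_eq_mul_reduced {m : ℕ} {H : Matrix (Fin m) (Fin (r + 1)) ℝ}
    {U : Matrix (Fin m) (Fin m) ℝ} {s : Fin r → ℝ} {V : Matrix (Fin (r + 1)) (Fin (r + 1)) ℝ}
    (h : IsSVD H U s V) :
    ∃ A : Matrix (Fin m) (Fin r) ℝ, Aᵀ * A = 1 ∧ H = A * reduced s V := by
  refine ⟨U.submatrix id (Fin.castLE h.le_rows), ?_, ?_⟩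
  · have hU : Uᵀ * U = 1 := (Matrix.mem_orthogonalGroup_iff' (Fin m) ℝ).1 h.orthogonal_left
    ext i j
    have := congrFun (congrFun hU (Fin.castLE h.le_rows i)) (Fin.castLE h.le_rows j)
    simpa [Matrix.mul_apply, Matrix.one_apply, Fin.ext_iff] using this
  · have hdiag : U * rectDiag m (r + 1) s =
        Matrix.of fun i b => if hb : b.val < r then
          U i (Fin.castLE h.le_rows ⟨b.val, hb⟩) * s ⟨b.val, hb⟩ else 0 := by
      ext i b
      rw [Matrix.mul_apply, Matrix.of_apply]
      split_ifs with hb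
      · rw [Finset.sum_eq_single (Fin.castLE h.le_rows ⟨b.val, hb⟩)]
        · simp [rectDiag, hb]
        · intro a _ ha
          have : ¬ (a.val = b.val ∧ a.val < r) := fun hab => ha (Fin.ext hab.1)
          simp [rectDiag, this]
        · simp
      · refine Finset.sum_eq_zero fun a _ => ?_
        have : ¬ (a.val = b.val ∧ a.val < r) := fun hab => hb (hab.1 ▸ hab.2)
        simp [rectDiag, this]
    refine h.eq.trans ?_
    rw [hdiag]
    ext i k
    rw [Matrix.mul_apply, Fin.sum_univ_castSucc, Matrix.mul_apply]
    simp [reduced, Matrix.diagonal_mul, mul_assoc]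
    rfl

/-- The cube `[0, 1]ⁿ`. -/
def cube (n : ℕ) : Set (EuclideanSpace ℝ (Fin n)) :=
  {x | ∀ i, x i ∈ Set.Icc (0 : ℝ) 1}

lemma isCompact_cube (n : ℕ) : IsCompact (cube n) := by
  have h : cube n = WithLp.toLp 2 '' (Set.univ.pi fun _ : Fin n => Set.Icc (0 : ℝ) 1) := by
    ext x
    constructor
    · intro hx
      exact ⟨x.ofLp, fun i _ => hx i, rfl⟩
    · rintro ⟨y, hy, rfl⟩ i
      exact hy i trivial
  rw [h]
  exact (isCompact_univ_pi fun _ => isCompact_Icc).image (PiLp.continuous_toLp 2 _)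

lemma zonotope_eq_image {n : ℕ} (A : Matrix (Fin r) (Fin n) ℝ) :
    zonotope A = act A '' cube n := by
  have h (x : Fin n → ℝ) :
      ∑ i, x i • WithLp.toLp 2 (fun j => A j i) = act A (WithLp.toLp 2 x) := by
    ext j
    simp [act_apply, mul_comm]
  ext y
  constructor
  · rintro ⟨x, hx, rfl⟩
    exact ⟨WithLp.toLp 2 x, hx, (h x).symm⟩
  · rintro ⟨x, hx, rfl⟩
    exact ⟨x.ofLp, hx, (h x.ofLp).symm⟩

lemma isCompact_zonotope {n : ℕ} (A : Matrix (Fin r) (Fin n) ℝ) : IsCompact (zonotope A) := by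
  rw [zonotope_eq_image]
  exact (isCompact_cube n).image (continuous_act A)

/-- The point `x` with `reduced s V *ᵥ x = y` whose inner product with the last column of `V`
is `t`. -/
noncomputable def preimagePoint (s : Fin r → ℝ) (V : Matrix (Fin (r + 1)) (Fin (r + 1)) ℝ) (t : ℝ)
    (y : EuclideanSpace ℝ (Fin r)) : EuclideanSpace ℝ (Fin (r + 1)) :=
  WithLp.toLp 2 fun i => ∑ j : Fin r, V i j.castSucc * (y j / s j) + V i (Fin.last r) * t

variable {s : Fin r → ℝ} {V : Matrix (Fin (r + 1)) (Fin (r + 1)) ℝ}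

lemma preimagePoint_apply (t : ℝ) (y : EuclideanSpace ℝ (Fin r)) (i : Fin (r + 1)) :
    preimagePoint s V t y i =
      ∑ j : Fin r, V i j.castSucc * (y j / s j) + V i (Fin.last r) * t := rfl

lemma preimagePoint_sub (t t' : ℝ) (y y' : EuclideanSpace ℝ (Fin r)) :
    preimagePoint s V (t - t') (y - y') = preimagePoint s V t y - preimagePoint s V t' y' := by
  ext i
  simp only [preimagePoint_apply, PiLp.sub_apply, sub_div, mul_sub, Finset.sum_sub_distrib]
  ring

lemma act_reduced_apply (x : EuclideanSpace ℝ (Fin (r + 1))) (j : Fin r) :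
    act (reduced s V) x j = s j * ∑ i, V i j.castSucc * x i := by
  simp [act_apply, reduced, Matrix.diagonal_mul, Finset.mul_sum, mul_assoc]

lemma sum_col_mul_col (hV : V ∈ Matrix.orthogonalGroup (Fin (r + 1)) ℝ) (a b : Fin (r + 1)) :
    ∑ i, V i a * V i b = if a = b then 1 else 0 := by
  have h := congrFun (congrFun ((Matrix.mem_orthogonalGroup_iff' (Fin (r + 1)) ℝ).1 hV) a) b
  simpa [Matrix.mul_apply, Matrix.one_apply] using h

lemma act_reduced_preimagePoint (hV : V ∈ Matrix.orthogonalGroup (Fin (r + 1)) ℝ)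
    (hs : ∀ j, 0 < s j) (t : ℝ) (y : EuclideanSpace ℝ (Fin r)) :
    act (reduced s V) (preimagePoint s V t y) = y := by
  ext j
  have h1 : ∀ i, V i j.castSucc * preimagePoint s V t y i =
      ∑ l : Fin r, (V i j.castSucc * V i l.castSucc) * (y l / s l) +
        (V i j.castSucc * V i (Fin.last r)) * t := fun i => by
    rw [preimagePoint_apply, mul_add, Finset.mul_sum]
    simp only [mul_assoc]
  rw [act_reduced_apply]
  simp only [h1]
  rw [Finset.sum_add_distrib, Finset.sum_comm]
  simp only [← Finset.sum_mul, sum_col_mul_col hV]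
  have := (hs j).ne'
  simp [Fin.castSucc_inj, (Fin.castSucc_lt_last j).ne]
  field_simp

/-- This expands `x` in the orthonormal basis of columns of `V`. -/
lemma preimagePoint_act_reduced (hV : V ∈ Matrix.orthogonalGroup (Fin (r + 1)) ℝ)
    (hs : ∀ j, 0 < s j) (x : EuclideanSpace ℝ (Fin (r + 1))) :
    preimagePoint s V ((fun i => V i (Fin.last r)) ⬝ᵥ x.ofLp) (act (reduced s V) x) = x := by
  ext i
  have hVV : V * Vᵀ = 1 := (Matrix.mem_orthogonalGroup_iff (Fin (r + 1)) ℝ).1 hV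
  have h : (V *ᵥ (Vᵀ *ᵥ x.ofLp)) i = x i := by
    rw [Matrix.mulVec_mulVec, hVV, Matrix.one_mulVec]
  have hsum : ∑ j : Fin r, V i j.castSucc * (Vᵀ *ᵥ x.ofLp) j.castSucc +
      V i (Fin.last r) * (Vᵀ *ᵥ x.ofLp) (Fin.last r) = x i := by
    rw [← Fin.sum_univ_castSucc (f := fun b => V i b * (Vᵀ *ᵥ x.ofLp) b)]
    exact h
  rw [preimagePoint_apply, ← hsum]
  congr 1
  refine Finset.sum_congr rfl fun j _ => ?_
  rw [act_reduced_apply, mul_div_cancel_left₀ _ (hs j).ne']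
  rfl

/-- The term is the parameter at which coordinate `i` reaches its bound: `0` if the entry of `V` is
positive, `1` if negative. Writing it relative to `t` turns comparison with `t` into a sign
condition. -/
lemma fmin_term_eq {y : EuclideanSpace ℝ (Fin r)} {i : Fin (r + 1)}
    (hi : V i (Fin.last r) ≠ 0) (t : ℝ) :
    (1 - Real.sign (V i (Fin.last r))) / (2 * V i (Fin.last r))
      - ∑ j : Fin r, V i j.castSucc * y j / (V i (Fin.last r) * s j) =
    t + ((1 - Real.sign (V i (Fin.last r))) / 2 - preimagePoint s V t y i) /
      V i (Fin.last r) := by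
  have h : ∑ j : Fin r, V i j.castSucc * y j / (V i (Fin.last r) * s j) =
      (∑ j : Fin r, V i j.castSucc * (y j / s j)) / V i (Fin.last r) := by
    rw [Finset.sum_div]
    refine Finset.sum_congr rfl fun j _ => ?_
    rw [mul_div_assoc', div_div, mul_comm (s j)]
  rw [h, preimagePoint_apply]
  field_simp
  ring

lemma nonempty_fmin_index (hV : V ∈ Matrix.orthogonalGroup (Fin (r + 1)) ℝ) :
    Nonempty {i : Fin (r + 1) // V i (Fin.last r) ≠ 0} := by
  by_contra h
  have h0 : ∀ i, V i (Fin.last r) = 0 := fun i => by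
    by_contra hi
    exact h ⟨⟨i, hi⟩⟩
  have := sum_col_mul_col hV (Fin.last r) (Fin.last r)
  simp [h0] at this

/-- Raising `t` raises the coordinates with positive entry and lowers those with negative entry, so
exactly these cube constraints bound `t` from below. -/
lemma fmin_le_iff (hV : V ∈ Matrix.orthogonalGroup (Fin (r + 1)) ℝ)
    (y : EuclideanSpace ℝ (Fin r)) (t : ℝ) :
    fmin s V y ≤ t ↔ ∀ i, (0 < V i (Fin.last r) → 0 ≤ preimagePoint s V t y i) ∧
      (V i (Fin.last r) < 0 → preimagePoint s V t y i ≤ 1) := by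
  have := nonempty_fmin_index hV
  rw [fmin, ciSup_le_iff (Set.finite_range _).bddAbove, Subtype.forall]
  refine forall_congr' fun i => ⟨fun h => ⟨fun hi => ?_, fun hi => ?_⟩, fun h hi => ?_⟩
  · have h := h hi.ne'
    rw [fmin_term_eq hi.ne' t, Real.sign_of_pos hi, add_le_iff_nonpos_right,
      div_le_iff₀ hi] at h
    linarith
  · have h := h hi.ne
    rw [fmin_term_eq hi.ne t, Real.sign_of_neg hi, add_le_iff_nonpos_right,
      div_le_iff_of_neg hi] at h
    linarith
  · rw [fmin_term_eq hi t, add_le_iff_nonpos_right]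
    rcases lt_or_gt_of_ne hi with hi | hi
    · rw [Real.sign_of_neg hi, div_le_iff_of_neg hi]
      linarith [h.2 hi]
    · rw [Real.sign_of_pos hi, div_le_iff₀ hi]
      linarith [h.1 hi]

lemma continuous_fmin (hV : V ∈ Matrix.orthogonalGroup (Fin (r + 1)) ℝ) :
    Continuous (fmin s V) := by
  have := nonempty_fmin_index hV
  unfold fmin
  simp only [← Finset.sup'_univ_eq_ciSup]
  exact Continuous.finset_sup'_apply _ fun i _ => by fun_prop

lemma fmin_act_le (hV : V ∈ Matrix.orthogonalGroup (Fin (r + 1)) ℝ) (hs : ∀ j, 0 < s j)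
    {x : EuclideanSpace ℝ (Fin (r + 1))} (hx : x ∈ cube (r + 1)) :
    fmin s V (act (reduced s V) x) ≤ (fun i => V i (Fin.last r)) ⬝ᵥ x.ofLp := by
  rw [fmin_le_iff hV, preimagePoint_act_reduced hV hs]
  exact fun i => ⟨fun _ => (hx i).1, fun _ => (hx i).2⟩

/-- The reflection `x ↦ 1 - x` of the cube. -/
lemma fmin_sub_act_le (hV : V ∈ Matrix.orthogonalGroup (Fin (r + 1)) ℝ) (hs : ∀ j, 0 < s j)
    {x : EuclideanSpace ℝ (Fin (r + 1))} (hx : x ∈ cube (r + 1)) :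
    fmin s V (WithLp.toLp 2 (reduced s V *ᵥ 1) - act (reduced s V) x) ≤
      (fun i => V i (Fin.last r)) ⬝ᵥ (1 - x.ofLp) := by
  have h : WithLp.toLp 2 (reduced s V *ᵥ 1) - act (reduced s V) x =
      act (reduced s V) (WithLp.toLp 2 1 - x) := by
    rw [act_sub]
    rfl
  rw [h]
  refine fmin_act_le hV hs fun i => ?_
  have := hx i
  simp only [PiLp.sub_apply, Pi.one_apply, Set.mem_Icc] at this ⊢
  constructor <;> linarith

lemma preimagePoint_mem_cube (hV : V ∈ Matrix.orthogonalGroup (Fin (r + 1)) ℝ)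
    (hs : ∀ j, 0 < s j) {y : EuclideanSpace ℝ (Fin r)} (hy : y ∈ zonotope (reduced s V)) {t : ℝ}
    (h1 : fmin s V y ≤ t)
    (h2 : fmin s V (WithLp.toLp 2 (reduced s V *ᵥ 1) - y) ≤
      (fun i => V i (Fin.last r)) ⬝ᵥ 1 - t) :
    preimagePoint s V t y ∈ cube (r + 1) := by
  rw [fmin_le_iff hV] at h1 h2
  have hrefl : preimagePoint s V ((fun i => V i (Fin.last r)) ⬝ᵥ 1 - t)
      (WithLp.toLp 2 (reduced s V *ᵥ 1) - y) = WithLp.toLp 2 1 - preimagePoint s V t y := by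
    rw [preimagePoint_sub]
    congr 1
    exact preimagePoint_act_reduced hV hs (WithLp.toLp 2 1)
  simp only [hrefl, PiLp.sub_apply, Pi.one_apply] at h2
  intro i
  rcases lt_trichotomy (V i (Fin.last r)) 0 with hi | hi | hi
  · exact ⟨by linarith [(h2 i).2 hi], (h1 i).2 hi⟩
  -- This coordinate does not depend on `t`, so it agrees with that of any cube point over `y`.
  · rw [zonotope_eq_image] at hy
    obtain ⟨x, hx, rfl⟩ := hy
    have h := congrArg (fun z : EuclideanSpace ℝ (Fin (r + 1)) => z i)
      (preimagePoint_act_reduced hV hs x)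
    simp only [preimagePoint_apply, hi, zero_mul] at h
    rw [preimagePoint_apply, hi, zero_mul, h]
    exact hx i
  · exact ⟨(h1 i).1 hi, by linarith [(h2 i).1 hi]⟩

end Geometry

end OpticalChannel

namespace OpticalChannel

/-! ### Which laws of `S` come from admissible inputs. -/

section Laws

variable {r : ℕ}

lemma integrable_of_continuous_of_ae_mem_isCompact {X E : Type*} [TopologicalSpace X] [T2Space X]
    [MeasurableSpace X] [OpensMeasurableSpace X] [NormedAddCommGroup E]
    [SecondCountableTopologyEither X E] {P : Measure X} [IsFiniteMeasure P] {K : Set X}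
    (hK : IsCompact K) (hP : ∀ᵐ x ∂P, x ∈ K) {f : X → E} (hf : Continuous f) :
    Integrable f P := by
  have h : IntegrableOn f K P :=
    hf.continuousOn.integrableOn_of_subset_isCompact hK hK.measurableSet Set.Subset.rfl
      (measure_ne_top P K)
  rwa [IntegrableOn, Measure.restrict_eq_self_of_ae_mem hP] at h

lemma EqualCost.ae_mem_cube {n : ℕ} {α : Fin n → ℝ} {P : Measure (EuclideanSpace ℝ (Fin n))}
    (h : EqualCost α P) : ∀ᵐ x ∂P, x ∈ cube n := by
  have h1 : ∀ᵐ x ∂P, ∀ k, ¬ 1 < x k := by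
    rw [ae_all_iff]
    intro k
    rw [ae_iff]
    simpa using h.peak k
  filter_upwards [h.nonneg, h1] with x hx0 hx1 i using ⟨hx0 i, not_lt.1 (hx1 i)⟩

lemma equalCost_of_ae_mem_cube {n : ℕ} {α : Fin n → ℝ} {P : Measure (EuclideanSpace ℝ (Fin n))}
    (h : ∀ᵐ x ∂P, x ∈ cube n) (hα : ∀ k, ∫ x, x k ∂P = α k) : EqualCost α P where
  nonneg := by
    filter_upwards [h] with x hx i using (hx i).1
  peak k := by
    have h1 : ∀ᵐ x ∂P, ¬ 1 < x k := by
      filter_upwards [h] with x hx using not_lt.2 (hx k).2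
    rw [ae_iff] at h1
    simpa using h1
  mean := hα

variable {s : Fin r → ℝ} {V : Matrix (Fin (r + 1)) (Fin (r + 1)) ℝ} {α : Fin (r + 1) → ℝ}

/-- The conditions on the law of `S` in the reduced channel. -/
structure IsAdmissible (s : Fin r → ℝ) (V : Matrix (Fin (r + 1)) (Fin (r + 1)) ℝ)
    (α : Fin (r + 1) → ℝ) (Q : Measure (EuclideanSpace ℝ (Fin r))) : Prop where
  support : Q.support ⊆ zonotope (reduced s V)
  mean : ∫ y, y ∂Q = WithLp.toLp 2 (reduced s V *ᵥ α)
  fmin_le : ∫ y, fmin s V y ∂Q ≤ (fun i => V i (Fin.last r)) ⬝ᵥ α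
  fmin_sub_le : ∫ y, fmin s V (WithLp.toLp 2 (reduced s V *ᵥ 1) - y) ∂Q ≤
    (fun i => V i (Fin.last r)) ⬝ᵥ (1 - α)

lemma EqualCost.isAdmissible_map (hV : V ∈ Matrix.orthogonalGroup (Fin (r + 1)) ℝ)
    (hs : ∀ j, 0 < s j) {P : Measure (EuclideanSpace ℝ (Fin (r + 1)))} [IsProbabilityMeasure P]
    (h : EqualCost α P) : IsAdmissible s V α (P.map (act (reduced s V))) := by
  have hcube := h.ae_mem_cube
  have hint {f : EuclideanSpace ℝ (Fin (r + 1)) → ℝ} (hf : Continuous f) : Integrable f P :=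
    integrable_of_continuous_of_ae_mem_isCompact (isCompact_cube (r + 1)) hcube hf
  have hcont := continuous_fmin (s := s) hV
  have hdot (β : Fin (r + 1) → ℝ) : ∫ x, β ⬝ᵥ x.ofLp ∂P = β ⬝ᵥ α := by
    simp only [dotProduct]
    rw [integral_finsetSum _ fun i _ => hint (by fun_prop)]
    exact Finset.sum_congr rfl fun i _ => by rw [integral_const_mul, h.mean i]
  refine ⟨?_, ?_, ?_, ?_⟩
  · refine Measure.support_subset_of_isClosed (isCompact_zonotope _).isClosed ?_
    rw [mem_ae_map_iff (by fun_prop) (isCompact_zonotope _).measurableSet]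
    filter_upwards [hcube] with x hx
    rw [zonotope_eq_image]
    exact Set.mem_image_of_mem _ hx
  · rw [integral_map (by fun_prop) (by fun_prop)]
    ext j
    rw [eval_integral_piLp fun i => hint (by fun_prop)]
    exact hdot (reduced s V j)
  · rw [integral_map (by fun_prop) hcont.aestronglyMeasurable, ← hdot]
    refine integral_mono_ae (hint (by fun_prop)) (hint (by fun_prop)) ?_
    filter_upwards [hcube] with x hx using fmin_act_le hV hs hx
  · rw [integral_map (by fun_prop) (by fun_prop), dotProduct_sub, ← hdot]
    have hone : (fun i => V i (Fin.last r)) ⬝ᵥ 1 - ∫ x, (fun i => V i (Fin.last r)) ⬝ᵥ x.ofLp ∂P =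
        ∫ x, (fun i => V i (Fin.last r)) ⬝ᵥ (1 - x.ofLp) ∂P := by
      simp only [dotProduct_sub]
      rw [integral_sub (integrable_const _) (hint (by fun_prop))]
      simp
    rw [hone]
    refine integral_mono_ae (hint (by fun_prop)) (hint (by fun_prop)) ?_
    filter_upwards [hcube] with x hx using fmin_sub_act_le hV hs hx

lemma IsAdmissible.exists_equalCost_map (hV : V ∈ Matrix.orthogonalGroup (Fin (r + 1)) ℝ)
    (hs : ∀ j, 0 < s j) {Q : Measure (EuclideanSpace ℝ (Fin r))} [IsProbabilityMeasure Q]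
    (h : IsAdmissible s V α Q) :
    ∃ g : EuclideanSpace ℝ (Fin r) → EuclideanSpace ℝ (Fin (r + 1)), Measurable g ∧
      (∀ y, act (reduced s V) (g y) = y) ∧ EqualCost α (Q.map g) := by
  have hZ : ∀ᵐ y ∂Q, y ∈ zonotope (reduced s V) :=
    Filter.mem_of_superset Measure.support_mem_ae h.support
  have hint {f : EuclideanSpace ℝ (Fin r) → ℝ} (hf : Continuous f) : Integrable f Q :=
    integrable_of_continuous_of_ae_mem_isCompact (isCompact_zonotope _) hZ hf
  set v : Fin (r + 1) → ℝ := fun i => V i (Fin.last r) with hv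
  set lo : EuclideanSpace ℝ (Fin r) → ℝ := fmin s V with hlo
  set hi : EuclideanSpace ℝ (Fin r) → ℝ := fun y =>
    v ⬝ᵥ 1 - fmin s V (WithLp.toLp 2 (reduced s V *ᵥ 1) - y) with hhi
  have hcf := continuous_fmin (s := s) hV
  have hclo : Continuous lo := hcf
  have hchi : Continuous hi := by fun_prop
  -- The weights come from the means alone, hence do not depend on `y`.
  have hmem : v ⬝ᵥ α ∈ segment ℝ (∫ y, lo y ∂Q) (∫ y, hi y ∂Q) := by
    have h1 := h.fmin_le
    have h2 := h.fmin_sub_le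
    have h3 : ∫ y, hi y ∂Q = v ⬝ᵥ 1 -
        ∫ y, fmin s V (WithLp.toLp 2 (reduced s V *ᵥ 1) - y) ∂Q := by
      rw [hhi, integral_sub (integrable_const _) (hint (by fun_prop))]
      simp
    rw [dotProduct_sub] at h2
    have h4 : v ⬝ᵥ α ≤ ∫ y, hi y ∂Q := by
      rw [h3]
      linarith
    rw [segment_eq_Icc (h1.trans h4)]
    exact ⟨h1, h4⟩
  obtain ⟨a, b, ha, hb, hab, hmean⟩ := hmem
  set t : EuclideanSpace ℝ (Fin r) → ℝ := fun y => a * lo y + b * hi y with ht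
  have hct : Continuous t := by fun_prop
  have hcg : Continuous fun y => preimagePoint s V (t y) y := by
    unfold preimagePoint
    fun_prop
  refine ⟨fun y => preimagePoint s V (t y) y, hcg.measurable,
    fun y => act_reduced_preimagePoint hV hs _ y, equalCost_of_ae_mem_cube ?_ fun k => ?_⟩
  · refine (ae_map_iff (p := fun x => x ∈ cube (r + 1)) hcg.aemeasurable
      (isCompact_cube (r + 1)).measurableSet).2 ?_
    filter_upwards [hZ] with y hy
    -- The parameter of any cube point over `y` lies between the two ends.
    have hle : lo y ≤ hi y := by
      obtain ⟨x, hx, rfl⟩ := (zonotope_eq_image (reduced s V)) ▸ hy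
      have h1 := fmin_act_le hV hs hx
      have h2 := fmin_sub_act_le hV hs hx
      rw [dotProduct_sub] at h2
      simp only [hlo, hhi, hv]
      linarith
    have hb' : a = 1 - b := by linarith
    refine preimagePoint_mem_cube hV hs hy ?_ ?_
    · have := mul_nonneg hb (sub_nonneg.2 hle)
      simp only [ht, hb']
      linarith
    · have := mul_nonneg ha (sub_nonneg.2 hle)
      have hb'' : b = 1 - a := by linarith
      have h3 : t y ≤ hi y := by
        simp only [ht, hb'']
        linarith
      simp only [hhi] at h3
      linarith
  · rw [integral_map hcg.aemeasurable (by fun_prop)]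
    have htmean : ∫ y, t y ∂Q = v ⬝ᵥ α := by
      rw [ht, integral_add (hint (by fun_prop)) (hint (by fun_prop)), integral_const_mul,
        integral_const_mul]
      exact hmean
    have hy (j : Fin r) : ∫ y, y j ∂Q = act (reduced s V) (WithLp.toLp 2 α) j := by
      rw [← eval_integral_piLp fun i => hint (by fun_prop), h.mean]
      rfl
    -- `preimagePoint` is linear in the pair `(t, y)`, so the mean is its value at the means, which
    -- is `α`.
    have hα := congrArg (fun z : EuclideanSpace ℝ (Fin (r + 1)) => z k)
      (preimagePoint_act_reduced hV hs (WithLp.toLp 2 α))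
    simp only [preimagePoint_apply] at hα ⊢
    rw [integral_add (hint (by fun_prop)) (hint (by fun_prop)),
      integral_finsetSum _ fun i _ => hint (by fun_prop), integral_const_mul, htmean, ← hα]
    refine congrArg₂ (· + ·) (Finset.sum_congr rfl fun j _ => ?_) rfl
    rw [integral_const_mul, integral_div, hy]

end Laws

end OpticalChannel

/-! ### The capacity identity. -/

theorem theorem2 {m r : ℕ} (hr : 1 ≤ r)
    (H : Matrix (Fin m) (Fin (r + 1)) ℝ) (hH : ∀ i j, 0 ≤ H i j) (hrank : H.rank = r)
    (U : Matrix (Fin m) (Fin m) ℝ) (s : Fin r → ℝ)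
    (V : Matrix (Fin (r + 1)) (Fin (r + 1)) ℝ)
    (hSVD : OpticalChannel.IsSVD H U s V)
    (α : Fin (r + 1) → ℝ) (hα : ∀ k, α k ∈ Set.Icc (0 : ℝ) 1)
    (σ : ℝ) (hσ : 0 < σ) :
    OpticalChannel.capacityEC H α σ =
      ⨆ (P : Measure (EuclideanSpace ℝ (Fin r))) (_ : IsProbabilityMeasure P)
        (_ : P.support ⊆ OpticalChannel.zonotope (OpticalChannel.reduced s V))
        (_ : ∫ y, y ∂P = WithLp.toLp 2 (OpticalChannel.reduced s V *ᵥ α))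
        (_ : ∫ y, OpticalChannel.fmin s V y ∂P ≤ (fun i => V i (Fin.last r)) ⬝ᵥ α)
        (_ : ∫ y, OpticalChannel.fmin s V
              (WithLp.toLp 2 (OpticalChannel.reduced s V *ᵥ 1) - y) ∂P
            ≤ (fun i => V i (Fin.last r)) ⬝ᵥ (1 - α)),
        OpticalChannel.mutualInfo (P.prod (OpticalChannel.noise r σ))
          (fun p => p.1) (fun p => p.1 + p.2) := by
  obtain ⟨A, hA, rfl⟩ := hSVD.exists_eq_mul_reduced
  have hV := hSVD.orthogonal_right
  have hs := hSVD.pos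
  refine le_antisymm ?_ ?_
  · refine iSup_le fun P => iSup_le fun _ => iSup_le fun hP => ?_
    have hQ := hP.isAdmissible_map hV hs
    refine (OpticalChannel.channelInfo_mul_le hA _ σ P).trans ?_
    exact le_iSup_of_le _ <| le_iSup_of_le inferInstance <| le_iSup_of_le hQ.support <|
      le_iSup_of_le hQ.mean <| le_iSup_of_le hQ.fmin_le <| le_iSup_of_le hQ.fmin_sub_le le_rfl
  · refine iSup_le fun Q => iSup_le fun _ => iSup_le fun h1 => iSup_le fun h2 =>
      iSup_le fun h3 => iSup_le fun h4 => ?_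
    obtain ⟨g, hg, hgB, hE⟩ :=
      (OpticalChannel.IsAdmissible.mk (α := α) h1 h2 h3 h4).exists_equalCost_map hV hs
    exact (OpticalChannel.le_channelInfo_map hA _ σ Q hg hgB).trans <| le_iSup_of_le (Q.map g) <|
      le_iSup_of_le (Measure.isProbabilityMeasure_map hg.aemeasurable) <| le_iSup_of_le hE le_rfl
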